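/- Conventions. $\mathbb F$ is a finite field, $I$ is a finite index set, and a code is a linear subspace $\mathcal C \subseteq \mathbb F^I$. Graphs are finite; loops and parallel edges are allowed. A tree is a connected graph without cycles (so without loops and parallel edges), and $E(v)$ is the set of edges incident with the vertex $v$. A graph decomposition of $\mathcal C$ is a pair $(\mathcal G,\omega)$ where $\mathcal G=(V,E)$ is a connected graph and $\omega : I \to V$ is any map; it is a tree decomposition of $\mathcal C$ if $\mathcal G$ is a tree. A realization $\Gamma$ of $\mathcal C$ extending $(\mathcal G,\omega)$ consists of finite-dimensional $\mathbb F$-vector spaces $\mathcal S_e$ ($e\in E$) and subspaces $C_v \subseteq \mathbb F^{\omega^{-1}(v)} \oplus \bigoplus_{e\in E(v)} \mathcal S_e$ ($v\in V$) with the following properties. Let $\mathfrak B$ be the space of all $((x_i)_{i\in I},(s_e)_{e\in E}) \in \mathbb F^I\oplus\bigoplus_{e\in E}\mathcal S_e$ such that $((x_i)_{i\in\omega^{-1}(v)},(s_e)_{e\in E(v)})\in C_v$ for all $v\in V$. Then $\mathfrak B$ projects onto $C_v$ for every $v \in V$ and onto $\mathcal S_e$ for every $e \in E$, and the image of its projection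 to $\mathbb F^I$ is $\mathcal C$. Put $\kappa(\Gamma)=\max_{v\in V}\dim C_v$, and let $\kappa(\mathcal C;\mathcal G,\omega)$ be the minimum of $\kappa(\Gamma)$ over all realizations $\Gamma$ of $\mathcal C$ extending $(\mathcal G,\omega)$. A vertex-cut tree of a connected graph $\mathcal G$ is a pair $(T,\beta)$ where $T$ is a tree and $\beta$ assigns to each $z\in V(T)$ a set $\beta(z)\subseteq V(\mathcal G)$, such that, with $\beta(X)=\bigcup_{x\in X}\beta(x)$: (1) $\beta(V(T))=V(\mathcal G)$; (2) $\beta(x)\cap\beta(y)\subseteq\beta(z)$ whenever $z$ lies on the path between $x$ and $y$ in $T$; (3) for each $z\in V(T)$, if $T_1,\dots,T_\delta$ are the components of $T-z$ and $V_i=\beta(V(T_i))\setminus\beta(z)$, then $\beta(z),V_1,\dots,V_\delta$ are pairwise disjoint with union $V(\mathcal G)$, and every neighbour of a vertex of $V_i$ lies in $V_i\cup\beta(z)$, for $i=1,\dots,\delta$. Its vc-width is $\max_{z\in V(T)}|\beta(z)|$. Theorem. Let $(\mathcal G,\omega)$ be a graph decomposition of a code $\mathcal C$, and let $(T,\beta)$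 be a vertex-cut tree of $\mathcal G$. Then there exists a tree decomposition $(T,\gamma)$ of $\mathcal C$ such that every realization $\Gamma$ of $\mathcal C$ extending $(\mathcal G,\omega)$ satisfies $$\kappa(\Gamma)\ \ge\ \frac{\kappa(\mathcal C;T,\gamma)}{\text{vc-width}(T,\beta)}.$$ Hence, for the same $\gamma$, $$\kappa(\mathcal C;\mathcal G,\omega)\ \ge\ \frac{\kappa(\mathcal C;T,\gamma)}{\text{vc-width}(T,\beta)}.$$ -/

import Mathlib

open scoped Graph

universe u v

namespace CodeGraph

/-! ### Graphs

Graphs are Mathlib's multigraphs `Graph V E` (loops and parallel edges allowed), with vertex set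
`V(G)` and edge set `E(G)`. -/

section Graphs

variable {V E Z D : Type*}

/-- `G` is connected (in particular it has a vertex). -/
def IsConnected (G : Graph V E) : Prop :=
  G.toSimpleGraph.Connected

/-- `T` is a tree: it has no loops and no parallel edges, it is connected, and it has no cycles. -/
def IsTree (T : Graph Z D) : Prop :=
  T.Simple ∧ T.toSimpleGraph.IsTree

/-- The set `E(v)` of edges incident with the vertex `v`. -/
abbrev IncidentEdge (G : Graph V E) (v : V(G)) : Type _ :=
  {e : E(G) // G.Inc (e : E) (v : V)}

/-- `N(W)`, the set of vertices that are adjacent to some vertex of `W`. -/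
def neighbors (G : Graph V E) (W : Set V(G)) : Set V(G) :=
  {x | ∃ w ∈ W, G.Adj (w : V) (x : V)}

/-- `(V₀, (Vᵢ)ᵢ)` is a star partition of the vertex set of `G`: the sets are pairwise disjoint
(some may be empty), they cover the vertex set, and `N(Vᵢ) ⊆ Vᵢ ∪ V₀` for every `i`. -/
structure IsStarPartition (G : Graph V E) {ι : Type*} (V₀ : Set V(G)) (W : ι → Set V(G)) :
    Prop where
  disjoint_center : ∀ i, Disjoint V₀ (W i)
  disjoint : ∀ i j, i ≠ j → Disjoint (W i) (W j)
  cover : V₀ ∪ ⋃ i, W i = Set.univ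
  neighbors_subset : ∀ i, neighbors G (W i) ⊆ W i ∪ V₀

/-- The components of `T - z`. -/
abbrev ComponentAway (T : Graph Z D) (z : V(T)) : Type _ :=
  (T.toSimpleGraph.induce {x | x ≠ z}).ConnectedComponent

/-- The set of vertices of `T` in the component `K` of `T - z`. -/
def ComponentAway.verts {T : Graph Z D} {z : V(T)} (K : ComponentAway T z) : Set V(T) :=
  {x | ∃ hx : x ≠ z, (T.toSimpleGraph.induce {x | x ≠ z}).connectedComponentMk ⟨x, hx⟩ = K}

/-- `(T, β)` is a vertex-cut tree of `G`. -/
structure IsVertexCutTree (G : Graph V E) (T : Graph Z D) (β : V(T) → Set V(G)) : Prop where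
  isTree : IsTree T
  /-- The sets `β z` cover the vertex set of `G`. -/
  cover : ⋃ z, β z = Set.univ
  /-- If `z` lies on the path between `x` and `y`, then `β x ∩ β y ⊆ β z`. -/
  inter_subset : ∀ (x y z : V(T)) (p : T.toSimpleGraph.Walk x y), p.IsPath → z ∈ p.support →
    β x ∩ β y ⊆ β z
  /-- Every `z` gives a star partition of the vertex set of `G`, with centre `β z` and one further
  part `β(K) \ β z` for each component `K` of `T - z`. -/
  star : ∀ z : V(T), IsStarPartition G (β z)
    (fun K : ComponentAway T z => (⋃ x ∈ K.verts, β x) \ β z)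

/-- The vc-width of `(T, β)`, that is, the maximum of `|β z|` over the vertices `z` of `T`. -/
noncomputable def vcWidth {G : Graph V E} {T : Graph Z D} (β : V(T) → Set V(G)) : ℕ :=
  ⨆ z : V(T), (β z).ncard

end Graphs

/-! ### Graphical models and realizations of codes -/

section Models

variable (F : Type u) [Field F] {I : Type v} {V E : Type*} (G : Graph V E) (ω : I → V(G))

/-- A graphical model over the field `F` that extends the graph decomposition `(G, ω)` of the
index set `I`: a finite-dimensional state space for every edge, and for every vertex `v` a local
constraint code, a subspace of `F^(ω⁻¹(v)) ⊕ ⨁_{e ∈ E(v)} S e`. -/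
structure GraphicalModel where
  S : E(G) → Type (max u v)
  [addCommGroup : ∀ e, AddCommGroup (S e)]
  [module : ∀ e, Module F (S e)]
  [finite : ∀ e, Module.Finite F (S e)]
  localCode : ∀ v : V(G),
    Submodule F (({i : I // ω i = v} → F) × ((e : IncidentEdge G v) → S e.1))

attribute [instance] GraphicalModel.addCommGroup GraphicalModel.module GraphicalModel.finite

namespace GraphicalModel

variable {F G ω} (Γ : GraphicalModel F G ω)

/-- Global configurations: values of all symbol variables and all state variables. -/
abbrev Config : Type _ := (I → F) × ((e : E(G)) → Γ.S e)

/-- The projection of a global configuration to the symbol variables. -/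
def symbols : Γ.Config →ₗ[F] (I → F) := LinearMap.fst F _ _

/-- The projection of a global configuration to the state variable of the edge `e`. -/
def state (e : E(G)) : Γ.Config →ₗ[F] Γ.S e :=
  LinearMap.proj e ∘ₗ LinearMap.snd F (I → F) ((e : E(G)) → Γ.S e)

/-- The local configuration at the vertex `v` of a global configuration. -/
def localConfig (v : V(G)) :
    Γ.Config →ₗ[F] (({i : I // ω i = v} → F) × ((e : IncidentEdge G v) → Γ.S e.1)) where
  toFun b := (fun i => b.1 i.1, fun e => b.2 e.1)
  map_add' _ _ := rfl
  map_smul' _ _ := rfl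

/-- The full behavior: the space of the global configurations that satisfy every local
constraint. -/
def fullBehavior : Submodule F Γ.Config where
  carrier := {b | ∀ v, Γ.localConfig v b ∈ Γ.localCode v}
  add_mem' ha hb v := by rw [map_add]; exact add_mem (ha v) (hb v)
  zero_mem' v := by rw [map_zero]; exact zero_mem _
  smul_mem' c _ hb v := by rw [map_smul]; exact Submodule.smul_mem _ c (hb v)

/-- `Γ` is essential: every element of a local constraint code, and every state, occurs in some
valid global configuration. -/
structure IsEssential : Prop where
  local_eq : ∀ v, Γ.fullBehavior.map (Γ.localConfig v) = Γ.localCode v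
  state_eq : ∀ e, Γ.fullBehavior.map (Γ.state e) = ⊤

/-- `Γ` is a (graphical) realization of the code `C`: it is essential, and its full behavior
projects onto `C`. -/
structure IsRealization (C : Submodule F (I → F)) : Prop where
  isEssential : Γ.IsEssential
  symbols_eq : Γ.fullBehavior.map Γ.symbols = C

/-- The `κ`-complexity of `Γ`, that is, the maximum dimension of a local constraint code. -/
noncomputable def kappa : ℕ :=
  ⨆ v : V(G), Module.finrank F (Γ.localCode v)

end GraphicalModel

variable {F}

/-- The set of the graphical realizations of `C` that extend `(G, ω)`. -/
def realizations (C : Submodule F (I → F)) : Set (GraphicalModel F G ω) :=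
  {Γ | Γ.IsRealization C}

/-- `κ(C; G, ω)`, the least `κ`-complexity of a realization of `C` that extends `(G, ω)`. -/
noncomputable def minKappa (C : Submodule F (I → F)) : ℕ :=
  sInf (GraphicalModel.kappa '' realizations G ω C)

/-! #### The minimum is attained -/

variable [Finite I] (C : Submodule F (I → F))

/-- A realization in which every state variable holds the whole codeword. -/
def repetitionModel : GraphicalModel F G ω where
  S _ := C
  localCode v := LinearMap.range
    (LinearMap.prod (LinearMap.pi fun i : {i : I // ω i = v} => LinearMap.proj i.1 ∘ₗ C.subtype)
      (LinearMap.pi fun _ : IncidentEdge G v => LinearMap.id))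

variable {G}

theorem repetitionModel_mem (c : C) :
    ((c : I → F), fun _ => c) ∈ (repetitionModel G ω C).fullBehavior :=
  fun _ => ⟨c, rfl⟩

theorem exists_of_mem_repetitionModel (hG : IsConnected G)
    {b : (repetitionModel G ω C).Config} (hb : b ∈ (repetitionModel G ω C).fullBehavior) :
    ∃ c : C, b = ((c : I → F), fun _ => c) := by
  choose f hf using hb
  have hsym (v : V(G)) (i : I) (h : ω i = v) : (f v : I → F) i = b.1 i :=
    congrFun (congrArg Prod.fst (hf v)) ⟨i, h⟩
  have hst (v : V(G)) (e : E(G)) (h : G.Inc (e : E) (v : V)) : f v = b.2 e :=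
    congrFun (congrArg Prod.snd (hf v)) ⟨e, h⟩
  have hadj (x y : V(G)) (h : G.toSimpleGraph.Adj x y) : f x = f y := by
    obtain ⟨-, e, he⟩ := h
    rw [hst x ⟨e, he.edge_mem⟩ he.inc_left, hst y ⟨e, he.edge_mem⟩ he.inc_right]
  have hwalk (x y : V(G)) (p : G.toSimpleGraph.Walk x y) : f x = f y := by
    induction p with
    | nil => rfl
    | cons h _ ih => exact (hadj _ _ h).trans ih
  obtain ⟨v₀⟩ := hG.nonempty
  have hconst (x : V(G)) : f x = f v₀ := hwalk _ _ (hG.preconnected x v₀).some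
  refine ⟨f v₀, Prod.ext ?_ ?_⟩
  · funext i
    change b.1 i = (f v₀ : I → F) i
    rw [← hsym _ i rfl, hconst]
  · funext e
    obtain ⟨x, y, h⟩ := (G.edge_mem_iff_exists_isLink _).1 e.2
    change b.2 e = f v₀
    rw [← hst ⟨x, h.left_mem⟩ e h.inc_left, hconst]

theorem repetitionModel_isRealization (hG : IsConnected G) :
    (repetitionModel G ω C).IsRealization C := by
  refine ⟨⟨fun v => le_antisymm ?_ ?_, fun e => ?_⟩, le_antisymm ?_ ?_⟩
  · rintro _ ⟨b, hb, rfl⟩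
    exact hb v
  · rintro _ ⟨c, rfl⟩
    exact ⟨_, repetitionModel_mem ω C c, rfl⟩
  · exact eq_top_iff.2 fun c _ => ⟨_, repetitionModel_mem ω C c, rfl⟩
  · rintro _ ⟨b, hb, rfl⟩
    obtain ⟨c, rfl⟩ := exists_of_mem_repetitionModel ω C hG hb
    exact c.2
  · exact fun c hc => ⟨_, repetitionModel_mem ω C ⟨c, hc⟩, rfl⟩

/-- On a connected graph, `κ(C; G, ω)` is the minimum of a nonempty set. -/
theorem isLeast_minKappa (hG : IsConnected G) :
    IsLeast (GraphicalModel.kappa '' realizations G ω C) (minKappa G ω C) :=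
  ⟨Nat.sInf_mem ⟨_, _, repetitionModel_isRealization ω C hG, rfl⟩, fun _ h => Nat.sInf_le h⟩

end Models

end CodeGraph

/-! Choose `γ` with `ω i ∈ β (γ i)` for every `i`; it does not depend on `Γ`. Let `treeModel` be the
model on `T` whose state at an edge is the codeword modulo those that split there. It realizes `C`
because local codewords that agree modulo splitting across each edge glue to a codeword
(`mem_of_indicator_side_mem`).

Its local code at `z` is small: a configuration of `Γ` that vanishes locally on `β z` can be cut
along the star partition at `z` (`indicator_symbols_mem`), so its codeword splits at every edge at
`z`, has zero symbols there, and is killed by `treeLocal`. Thus the local code is a quotient of the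
restriction of the behavior of `Γ` to `∏ v ∈ β z, C_v`, of dimension at most `|β z| κ(Γ)`. -/

namespace CodeGraph

/-! ### Sides of the edges of a tree -/

section Sides

variable {α : Type*} {H : SimpleGraph α}

/-- The set of the vertices that can be reached from `v` by a walk that avoids `u`. -/
def side (H : SimpleGraph α) (u v : α) : Set α :=
  {w | ∃ p : H.Walk v w, u ∉ p.support}

/-- Paths are unique: a walk from `v` avoiding `u`, prefixed by the edge, would be a second path
from `u`. Conversely, once the path from `u` reaches `v`, it no longer meets `u`. -/
theorem mem_side_swap_iff (hH : H.IsTree) {u v : α} (h : H.Adj u v) (w : α) :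
    w ∈ side H v u ↔ w ∉ side H u v := by
  classical
  refine ⟨?_, fun hw => ?_⟩
  · rintro ⟨q, hq⟩ ⟨p, hp⟩
    have h₁ : (SimpleGraph.Walk.cons h p.bypass).IsPath :=
      (p.bypass_isPath).cons fun hu => hp (p.support_bypass_subset_support hu)
    have h₂ : SimpleGraph.Walk.cons h p.bypass = q.bypass := congrArg Subtype.val
      (hH.isAcyclic.subsingleton_path u w |>.elim ⟨_, h₁⟩ ⟨_, q.bypass_isPath⟩)
    apply hq
    apply q.support_bypass_subset_support
    rw [← h₂]
    simp
  · obtain ⟨p, hp, -⟩ := hH.existsUnique_path u w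
    refine ⟨p, fun hv => hw ⟨p.dropUntil v hv, fun hu => ?_⟩⟩
    have hnd := hp.support_nodup
    rw [← p.take_spec hv, SimpleGraph.Walk.support_append] at hnd
    refine (List.nodup_append.1 hnd).2.2 u (p.takeUntil v hv).start_mem_support u ?_ rfl
    rcases (SimpleGraph.Walk.mem_support_iff _).1 hu with h' | h'
    · exact absurd h' h.ne
    · exact h'

theorem side_swap (hH : H.IsTree) {u v : α} (h : H.Adj u v) : side H v u = (side H u v)ᶜ :=
  Set.ext (mem_side_swap_iff hH h)

/-- With `T` rooted at `r` and `u` the parent of `v`, the side of `v` is the set of its descendants.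
-/
theorem mem_support_iff_mem_side (hH : H.IsTree) {r v u w : α} (h : H.Adj v u) {q : H.Walk u r}
    (hq : (SimpleGraph.Walk.cons h q).IsPath) {p : H.Walk w r} (hp : p.IsPath) :
    v ∈ p.support ↔ w ∈ side H u v := by
  classical
  constructor
  · intro hv
    have hd : p.dropUntil v hv = SimpleGraph.Walk.cons h q := congrArg Subtype.val
      (hH.isAcyclic.subsingleton_path v r |>.elim ⟨_, hp.dropUntil hv⟩ ⟨_, hq⟩)
    refine ⟨(p.takeUntil v hv).reverse, fun hu => ?_⟩
    rw [SimpleGraph.Walk.support_reverse, List.mem_reverse] at hu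
    have hnd := hp.support_nodup
    rw [← p.take_spec hv, SimpleGraph.Walk.support_append] at hnd
    refine (List.nodup_append.1 hnd).2.2 u hu u ?_ rfl
    rw [hd]
    simp
  · intro hw
    by_contra hv
    refine (mem_side_swap_iff hH h.symm w).1 ⟨q.append p.reverse, ?_⟩ hw
    rw [SimpleGraph.Walk.mem_support_append_iff, SimpleGraph.Walk.support_reverse,
      List.mem_reverse]
    rintro (h' | h')
    · exact ((SimpleGraph.Walk.cons_isPath_iff h q).1 hq).2 h'
    · exact hv h'

/-- If the differences along the edges of a tree, restricted to the sides of these edges, lie in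
`C`, then the function that is composed of the values of `f` lies in `C`. -/
theorem mem_of_indicator_side_mem [Finite α] (hH : H.IsTree) {F I : Type*} [Ring F]
    (C : Submodule F (I → F)) (γ : I → α) (f : α → I → F) (hf : ∀ v, f v ∈ C)
    (hadj : ∀ u v, H.Adj u v → (γ ⁻¹' side H u v).indicator (f v - f u) ∈ C) :
    (fun i => f (γ i) i) ∈ C := by
  classical
  have := Fintype.ofFinite α
  obtain ⟨r⟩ := hH.connected.nonempty
  choose P hP hPu using fun w => hH.existsUnique_path w r
  -- `(P v).snd` is the parent of `v`; for `v = r` it is `r` itself, so that term is zero.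
  have telescope (g : α → F) (w : α) (p : H.Walk w r) (hp : p.IsPath) :
      ∑ v ∈ p.support.toFinset, (g v - g (P v).snd) = g w - g r := by
    induction p with
    | nil =>
      simp [← hPu _ _ hp]
    | @cons w u r h q ih =>
      have hq := (SimpleGraph.Walk.cons_isPath_iff h q).1 hp
      rw [SimpleGraph.Walk.support_cons, List.toFinset_cons, Finset.sum_insert (by simpa using hq.2),
        ih P hP hPu hq.1, ← hPu w _ hp, SimpleGraph.Walk.snd_cons]
      abel
  have hx : (fun i => f (γ i) i) = f r + ∑ v, {i | v ∈ (P (γ i)).support}.indicator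
      (f v - f (P v).snd) := by
    funext i
    have h := telescope (fun v => f v i) _ _ (hP (γ i))
    rw [Pi.add_apply, Finset.sum_apply, ← sub_eq_iff_eq_add', ← h,
      ← Finset.sum_filter_add_sum_filter_not Finset.univ (fun v => v ∈ (P (γ i)).support)]
    have h0 : ∑ v with v ∉ (P (γ i)).support, {i | v ∈ (P (γ i)).support}.indicator
        (f v - f (P v).snd) i = 0 :=
      Finset.sum_eq_zero fun v hv => Set.indicator_of_notMem (by simpa using hv) _
    rw [h0, add_zero]
    refine Finset.sum_congr (by ext; simp) fun v hv => ?_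
    rw [Set.indicator_of_mem (by simpa using hv)]
    rfl
  rw [hx]
  refine add_mem (hf r) (sum_mem fun v _ => ?_)
  have key (p : H.Walk v r) (hp : p.IsPath) :
      {i | v ∈ (P (γ i)).support}.indicator (f v - f p.snd) ∈ C := by
    cases p with
    | nil => simp
    | cons h q =>
      have hs : {i | v ∈ (P (γ i)).support} = γ ⁻¹' side H _ v :=
        Set.ext fun i => mem_support_iff_mem_side hH h hp (hP (γ i))
      rw [hs, SimpleGraph.Walk.snd_cons]
      exact hadj _ _ h.symm
  exact key _ (hP v)

/-- Matches the parts of a star partition with the sides used in `splitAt`. -/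
theorem ComponentAway.verts_mk {Z D : Type*} {T : Graph Z D} {z y : V(T)} (hy : y ≠ z) :
    ComponentAway.verts ((T.toSimpleGraph.induce {x | x ≠ z}).connectedComponentMk ⟨y, hy⟩) =
      side T.toSimpleGraph z y := by
  ext w
  constructor
  · rintro ⟨hw, h⟩
    obtain ⟨p⟩ := (SimpleGraph.ConnectedComponent.eq.1 h).symm
    refine ⟨p.map (SimpleGraph.Embedding.induce _).toHom, fun hz => ?_⟩
    erw [SimpleGraph.Walk.support_map, List.mem_map] at hz
    obtain ⟨a, -, ha⟩ := hz
    exact a.2 ha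
  · rintro ⟨p, hp⟩
    have hall : ∀ x ∈ p.support, x ∈ {x | x ≠ z} := fun x hx hxz => hp (hxz ▸ hx)
    exact ⟨hall _ p.end_mem_support,
      SimpleGraph.ConnectedComponent.eq.2 ⟨(p.induce _ hall).reverse⟩⟩

end Sides

/-! ### The tree realization of a code -/

section TreeModel

variable {F : Type u} [Field F] {I : Type v} {Z D : Type*} (T : Graph Z D) (γ : I → V(T))
  (C : Submodule F (I → F))

/-- The codewords whose restrictions to both sides of the edge `e` are codewords. -/
def splitAt (e : E(T)) : Submodule F C where
  carrier := {c | ∀ u v : V(T), T.IsLink (e : D) (u : Z) (v : Z) →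
    (γ ⁻¹' side T.toSimpleGraph u v).indicator (c : I → F) ∈ C}
  add_mem' ha hb u v h := by
    rw [Submodule.coe_add, Set.indicator_add']
    exact add_mem (ha u v h) (hb u v h)
  zero_mem' u v h := by simp
  smul_mem' a c hc u v h := by
    convert C.smul_mem a (hc u v h) using 1
    exact Set.indicator_const_smul _ a (c : I → F)

/-- The symbols at `z` of a codeword, and its classes modulo the codewords that split at the
edges incident with `z`. -/
def treeLocal (z : V(T)) : C →ₗ[F] ({i : I // γ i = z} → F) ×
    ((e : IncidentEdge T z) → C ⧸ splitAt T γ C e.1) :=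
  LinearMap.prod (LinearMap.pi fun i => LinearMap.proj i.1 ∘ₗ C.subtype)
    (LinearMap.pi fun e => (splitAt T γ C e.1).mkQ)

variable [Finite I]

/-- The model in which the state at an edge `e` is the class of the codeword modulo the codewords
that split at `e`. -/
def treeModel : GraphicalModel F T γ where
  S e := C ⧸ splitAt T γ C e
  localCode z := LinearMap.range (treeLocal T γ C z)

variable {T}

theorem treeModel_mem (c : C) :
    ((c : I → F), fun e => (splitAt T γ C e).mkQ c) ∈ (treeModel T γ C).fullBehavior :=
  fun _ => ⟨c, rfl⟩

theorem treeModel_isRealization [Finite V(T)] (hT : IsTree T) :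
    (treeModel T γ C).IsRealization C := by
  refine ⟨⟨fun v => le_antisymm ?_ ?_, fun e => ?_⟩, le_antisymm ?_ ?_⟩
  · rintro _ ⟨b, hb, rfl⟩
    exact hb v
  · rintro _ ⟨c, rfl⟩
    exact ⟨_, treeModel_mem γ C c, rfl⟩
  · refine eq_top_iff.2 fun s _ => ?_
    obtain ⟨c, rfl⟩ := (splitAt T γ C e).mkQ_surjective s
    exact ⟨_, treeModel_mem γ C c, rfl⟩
  · rintro _ ⟨b, hb, rfl⟩
    choose f hf using hb
    have hsym : (treeModel T γ C).symbols b = fun i => (f (γ i) : I → F) i := by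
      funext i
      exact (congrFun (congrArg Prod.fst (hf (γ i))) ⟨i, rfl⟩).symm
    have hst (v : V(T)) (e : E(T)) (h : T.Inc (e : D) (v : Z)) :
        (splitAt T γ C e).mkQ (f v) = b.2 e :=
      congrFun (congrArg Prod.snd (hf v)) ⟨e, h⟩
    rw [hsym]
    -- The codewords `f u` and `f v` share the state on the edge `uv`, so their difference splits
    -- there.
    refine mem_of_indicator_side_mem hT.2 C γ (fun v => (f v : I → F)) (fun v => (f v).2) ?_
    rintro u v ⟨-, e, he⟩
    have h := (hst v ⟨e, he.edge_mem⟩ he.inc_right).trans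
      (hst u ⟨e, he.edge_mem⟩ he.inc_left).symm
    exact (Submodule.Quotient.eq _).1 h u v he
  · exact fun c hc => ⟨_, treeModel_mem γ C ⟨c, hc⟩, rfl⟩

end TreeModel

/-! ### Cutting a configuration along a star partition -/

section Cut

variable {F : Type u} [Field F] {I : Type v} {V E : Type*} {G : Graph V E} {ω : I → V(G)}

/-- If a configuration vanishes at the vertices of `V₀`, and `N(W) ⊆ W ∪ V₀`, then its
restriction to `W` is again valid. -/
theorem indicator_symbols_mem (Γ : GraphicalModel F G ω) {V₀ W : Set V(G)}
    (hW : neighbors G W ⊆ W ∪ V₀) {b : Γ.Config} (hb : b ∈ Γ.fullBehavior)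
    (h0 : ∀ v ∈ V₀, Γ.localConfig v b = 0) :
    (ω ⁻¹' W).indicator (Γ.symbols b) ∈ Γ.fullBehavior.map Γ.symbols := by
  classical
  -- States are kept exactly on the edges that meet `W`. Such an edge with an end outside `W` has
  -- that end in `V₀`, so its state is already zero.
  refine ⟨((ω ⁻¹' W).indicator (Γ.symbols b),
    fun e => if ∃ w ∈ W, G.Inc (e : E) (w : V) then b.2 e else 0), fun v => ?_, rfl⟩
  by_cases hv : v ∈ W
  · convert hb v using 1
    refine Prod.ext (funext fun i => ?_) (funext fun e => ?_)
    · exact Set.indicator_of_mem (by rwa [Set.mem_preimage, i.2]) (Γ.symbols b)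
    · exact if_pos ⟨v, hv, e.2⟩
  · convert (Γ.localCode v).zero_mem using 1
    refine Prod.ext (funext fun i => ?_) (funext fun e => ?_)
    · exact Set.indicator_of_notMem (show i.1 ∉ ω ⁻¹' W from fun h => hv (i.2 ▸ h)) (Γ.symbols b)
    · change (if ∃ w ∈ W, G.Inc (e.1 : E) (w : V) then b.2 e.1 else 0) = 0
      split_ifs with h
      · obtain ⟨w, hw, hew⟩ := h
        have hne : (w : V) ≠ v := fun h => hv (Subtype.ext h ▸ hw)
        obtain ⟨y, hy⟩ := hew
        obtain rfl : (v : V) = y := (Graph.Inc.eq_or_eq_of_isLink e.2 hy).resolve_left hne.symm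
        have hadj : G.Adj (w : V) (v : V) := ⟨e.1, hy⟩
        have hv0 : v ∈ V₀ := (hW ⟨w, hw, hadj⟩).resolve_left hv
        exact congrFun (congrArg Prod.snd (h0 v hv0)) e
      · rfl

/-- The number of vertices of `V₀` times the complexity bounds the rank of every linear map on
`C` that vanishes on the symbols of the valid configurations that vanish at `V₀`. -/
theorem finrank_range_le_ncard_mul_kappa [Finite I] [Finite V(G)] [Finite E(G)]
    {Γ : GraphicalModel F G ω} {C : Submodule F (I → F)} (hΓ : Γ.IsRealization C)
    (V₀ : Set V(G)) {M : Type*} [AddCommMonoid M] [Module F M] (τ : C →ₗ[F] M)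
    (hτ : ∀ b ∈ Γ.fullBehavior, ∀ hb : Γ.symbols b ∈ C,
      (∀ v ∈ V₀, Γ.localConfig v b = 0) → τ ⟨Γ.symbols b, hb⟩ = 0) :
    Module.finrank F (LinearMap.range τ) ≤ V₀.ncard * Γ.kappa := by
  classical
  have := Fintype.ofFinite V(G)
  let := Module.addCommMonoidToAddCommGroup F (M := M)
  have hmem (b : Γ.fullBehavior) : Γ.symbols b ∈ C :=
    hΓ.symbols_eq ▸ Submodule.mem_map_of_mem b.2
  let σ : Γ.fullBehavior →ₗ[F] C := (Γ.symbols.domRestrict Γ.fullBehavior).codRestrict C hmem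
  have hσ : LinearMap.range σ = ⊤ := by
    refine eq_top_iff.2 fun c _ => ?_
    have hc : (c : I → F) ∈ Γ.fullBehavior.map Γ.symbols := hΓ.symbols_eq ▸ c.2
    obtain ⟨b, hb, hbc⟩ := hc
    exact ⟨⟨b, hb⟩, Subtype.ext hbc⟩
  rw [← LinearMap.range_comp_of_range_eq_top τ hσ]
  let R : Γ.fullBehavior →ₗ[F] ((v : V₀) → Γ.localCode v) :=
    LinearMap.pi fun v => ((Γ.localConfig v.1).domRestrict Γ.fullBehavior).codRestrict
      (Γ.localCode v.1) fun b => b.2 v.1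
  -- `τ ∘ₗ σ` factors through the restriction `R` to `V₀`, so its rank is at most that of `R`.
  have hker : LinearMap.ker R ≤ LinearMap.ker (τ ∘ₗ σ) := fun b hb => hτ b b.2 (hmem b) fun v hv =>
    congrArg Subtype.val (congrFun (LinearMap.mem_ker.1 hb) ⟨v, hv⟩)
  have h₁ := (τ ∘ₗ σ).finrank_range_add_finrank_ker
  have h₂ := R.finrank_range_add_finrank_ker
  have h₃ := Submodule.finrank_mono hker
  have h₄ := (LinearMap.range R).finrank_le
  rw [Module.finrank_pi_fintype] at h₄
  have h₅ : ∑ v : V₀, Module.finrank F (Γ.localCode v) ≤ ∑ _v : V₀, Γ.kappa :=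
    Finset.sum_le_sum fun v _ => le_ciSup
      (f := fun v => Module.finrank F (Γ.localCode v)) (Set.finite_range _).bddAbove v.1
  rw [Finset.sum_const, Finset.card_univ, ← Nat.card_eq_fintype_card, Nat.card_coe_set_eq,
    smul_eq_mul] at h₅
  omega

end Cut

/-! ### Vertex-cut trees -/

section VertexCut

variable {F : Type u} [Field F] {I : Type v} {V E Z D : Type*} {G : Graph V E} {ω : I → V(G)}
  {T : Graph Z D} {β : V(T) → Set V(G)} {γ : I → V(T)} {C : Submodule F (I → F)}

theorem indicator_side_symbols_mem (hβ : IsVertexCutTree G T β) (hγ : ∀ i, ω i ∈ β (γ i))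
    {Γ : GraphicalModel F G ω} (hΓ : Γ.IsRealization C) {z y : V(T)} (hy : y ≠ z)
    {b : Γ.Config} (hb : b ∈ Γ.fullBehavior) (h0 : ∀ v ∈ β z, Γ.localConfig v b = 0) :
    (γ ⁻¹' side T.toSimpleGraph z y).indicator (Γ.symbols b) ∈ C := by
  classical
  let K : ComponentAway T z := (T.toSimpleGraph.induce {x | x ≠ z}).connectedComponentMk ⟨y, hy⟩
  have hmem := indicator_symbols_mem Γ ((hβ.star z).neighbors_subset K) hb h0
  rw [hΓ.symbols_eq] at hmem
  have hzero (i : I) (hi : ω i ∈ β z) : Γ.symbols b i = 0 :=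
    congrFun (congrArg Prod.fst (h0 _ hi)) ⟨i, rfl⟩
  convert hmem using 1
  rw [← ComponentAway.verts_mk hy]
  funext i
  -- On `β z` the symbols vanish; off it, disjointness of the parts forces `γ i` and `ω i` to belong
  -- to the same component.
  by_cases hi : ω i ∈ β z
  · rw [Set.indicator_apply, Set.indicator_apply, hzero i hi, ite_self, ite_self]
  have hiff : γ i ∈ K.verts ↔ ω i ∈ (⋃ x ∈ K.verts, β x) \ β z := by
    refine ⟨fun h => ⟨Set.mem_biUnion h (hγ i), hi⟩, fun h => ?_⟩
    have hne : γ i ≠ z := fun h' => hi (h' ▸ hγ i)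
    by_contra hK
    let K' : ComponentAway T z :=
      (T.toSimpleGraph.induce {x | x ≠ z}).connectedComponentMk ⟨γ i, hne⟩
    have hK' : γ i ∈ K'.verts := ⟨hne, rfl⟩
    have hKK : K ≠ K' := fun h => hK (h ▸ hK')
    exact Set.disjoint_left.1 ((hβ.star z).disjoint K K' hKK) h
      ⟨Set.mem_biUnion hK' (hγ i), hi⟩
  rw [Set.indicator_apply, Set.indicator_apply]
  exact if_congr hiff rfl rfl

theorem treeLocal_symbols_eq_zero (hβ : IsVertexCutTree G T β) (hγ : ∀ i, ω i ∈ β (γ i))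
    {Γ : GraphicalModel F G ω} (hΓ : Γ.IsRealization C) {z : V(T)} {b : Γ.Config}
    (hb : b ∈ Γ.fullBehavior) (hbC : Γ.symbols b ∈ C) (h0 : ∀ v ∈ β z, Γ.localConfig v b = 0) :
    treeLocal T γ C z ⟨Γ.symbols b, hbC⟩ = 0 := by
  have := hβ.isTree.1
  refine Prod.ext (funext fun i => ?_) (funext fun e => ?_)
  · have hi : ω i.1 ∈ β z := (congrArg β i.2) ▸ hγ i.1
    exact congrFun (congrArg Prod.fst (h0 _ hi)) ⟨i.1, rfl⟩
  · refine (Submodule.Quotient.mk_eq_zero _).2 fun u w huw => ?_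
    have hne : u ≠ w := fun h => huw.adj.ne (congrArg Subtype.val h)
    rcases e.2.eq_or_eq_of_isLink huw with h | h
    · obtain rfl : z = u := Subtype.ext h
      exact indicator_side_symbols_mem hβ hγ hΓ hne.symm hb h0
    · obtain rfl : z = w := Subtype.ext h
      have hadj : T.toSimpleGraph.Adj z u := ⟨hne.symm, _, huw.symm⟩
      -- Here the side in question contains `z`; restricting to it is subtracting the restriction to
      -- the far side.
      rw [side_swap hβ.isTree.2 hadj, Set.preimage_compl, Set.indicator_compl]
      exact sub_mem hbC (indicator_side_symbols_mem hβ hγ hΓ hne hb h0)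

theorem finrank_range_treeLocal_le [Finite I] [Finite V(G)] [Finite E(G)]
    (hβ : IsVertexCutTree G T β) (hγ : ∀ i, ω i ∈ β (γ i)) {Γ : GraphicalModel F G ω}
    (hΓ : Γ.IsRealization C) (z : V(T)) :
    Module.finrank F (LinearMap.range (treeLocal T γ C z)) ≤ (β z).ncard * Γ.kappa :=
  finrank_range_le_ncard_mul_kappa hΓ (β z) (treeLocal T γ C z) fun _ hb hbC h0 =>
    treeLocal_symbols_eq_zero hβ hγ hΓ hb hbC h0

theorem minKappa_le_vcWidth_mul_kappa [Finite I] [Finite V(G)] [Finite E(G)] [Finite V(T)]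
    (hβ : IsVertexCutTree G T β) (hγ : ∀ i, ω i ∈ β (γ i)) {Γ : GraphicalModel F G ω}
    (hΓ : Γ.IsRealization C) : minKappa T γ C ≤ vcWidth β * Γ.kappa := by
  have hle : minKappa T γ C ≤ (treeModel T γ C).kappa :=
    Nat.sInf_le (Set.mem_image_of_mem _ (treeModel_isRealization γ C hβ.isTree))
  refine hle.trans (ciSup_le' fun z => ?_)
  exact (finrank_range_treeLocal_le hβ hγ hΓ z).trans (Nat.mul_le_mul_right _
    (le_ciSup (f := fun z => (β z).ncard) (Set.finite_range _).bddAbove z))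

end VertexCut

end CodeGraph

theorem mainTheorem2 {F : Type*} [Field F] [Finite F] {I : Type*} [Finite I]
    (C : Submodule F (I → F))
    {V E : Type*} (G : Graph V E) [Finite V(G)] [Finite E(G)] (hG : CodeGraph.IsConnected G)
    (ω : I → V(G))
    {Z D : Type*} (T : Graph Z D) [Finite V(T)] (β : V(T) → Set V(G))
    (hβ : CodeGraph.IsVertexCutTree G T β) :
    ∃ γ : I → V(T),
      (∀ Γ ∈ CodeGraph.realizations G ω C,
        (Γ.kappa : ℝ) ≥ (CodeGraph.minKappa T γ C : ℝ) / (CodeGraph.vcWidth β : ℝ)) ∧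
      (CodeGraph.minKappa G ω C : ℝ) ≥
        (CodeGraph.minKappa T γ C : ℝ) / (CodeGraph.vcWidth β : ℝ) := by
  choose γ hγ using fun i => Set.mem_iUnion.1 (hβ.cover.symm ▸ Set.mem_univ (ω i))
  have key : ∀ Γ ∈ CodeGraph.realizations G ω C,
      (Γ.kappa : ℝ) ≥ (CodeGraph.minKappa T γ C : ℝ) / (CodeGraph.vcWidth β : ℝ) := by
    intro Γ hΓ
    -- Nonnegativity suffices: a zero width makes the quotient zero.
    refine div_le_of_le_mul₀ (Nat.cast_nonneg _) (Nat.cast_nonneg _) ?_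
    rw [mul_comm]
    exact_mod_cast CodeGraph.minKappa_le_vcWidth_mul_kappa hβ hγ hΓ
  refine ⟨γ, key, ?_⟩
  obtain ⟨Γ, hΓ, h⟩ := (CodeGraph.isLeast_minKappa ω C hG).1
  exact h ▸ key Γ hΓ
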